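/- Let $\mathcal{G}$ and $\mathcal{H}$ be second countable, locally compact Hausdorff groupoids with Haar systems, and let $Z$ be a locally compact Hausdorff space which is a $(\mathcal{G},\mathcal{H})$-equivalence: there are commuting, free and proper continuous actions of $\mathcal{G}$ on the left and of $\mathcal{H}$ on the right of $Z$, whose anchor maps $r : Z \to \mathcal{G}^{(0)}$ and $s : Z \to \mathcal{H}^{(0)}$ are continuous open surjections inducing homeomorphisms $Z/\mathcal{H} \cong \mathcal{G}^{(0)}$ and $\mathcal{G}\backslash Z \cong \mathcal{H}^{(0)}$. Let $(\mathcal{A},\mathcal{G},\alpha)$ be a groupoid dynamical system: $\mathcal{A}$ is an upper semi-continuous bundle of $C^*$-algebras over $\mathcal{G}^{(0)}$ and $\alpha_\gamma : A_{s(\gamma)} \to A_{r(\gamma)}$, $\gamma \in \mathcal{G}$, are $*$-isomorphisms with $\alpha_{\gamma\eta}=\alpha_\gamma\alpha_\eta$ when $s(\gamma)=r(\eta)$, $\alpha_{\gamma^{-1}}=\alpha_\gamma^{-1}$, and $(\gamma,a)\mapsto \alpha_\gamma(a)$ continuous. Say that an upper semi-continuous bundle of $C^*$-algebras has enough sections if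 every element of every fibre is the value at the corresponding point of a compactly supported continuous section, and assume that $\mathcal{A}$ has enough sections. (a) For every $z_0 \in Z$, every $a \in A_{r(z_0)}$ and every $\epsilon > 0$ there is a continuous function $f : Z \to \mathcal{A}$ such that 1. $f(z) \in A_{r(z)}$ for all $z \in Z$, 2. $f(\gamma z) = \alpha_\gamma(f(z))$ for all $\gamma \in \mathcal{G}$ and $z \in Z$ with $s(\gamma) = r(z)$, 3. $\|f(z_0) - a\| \le \epsilon$. (b) Let $r^*\mathcal{A} = \{(z,a) \in Z \times \mathcal{A} : a \in A_{r(z)}\}$, on which $\mathcal{G}$ acts by $\gamma(z,a) = (\gamma z, \alpha_\gamma(a))$, and let $\mathcal{A}_Z = \mathcal{G}\backslash r^*\mathcal{A}$ be the quotient, an upper semi-continuous bundle of $C^*$-algebras over $\mathcal{H}^{(0)}$ with projection $[(z,a)] \mapsto s(z)$ and fibrewise operations $[(z,a)]+[(z,b)]=[(z,a+b)]$, etc. Then $\mathcal{A}_Z$ has enough sections. -/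

import Mathlib

open Set Filter Topology MeasureTheory

/-! ## Topological groupoids and Haar systems -/

/-- A topological groupoid with arrow space `G` and unit space `X`.  Since `unit` is continuous and
`r ∘ unit = id`, the space `X` is identified by `unit` with the subspace of units of `G`. -/
structure TopologicalGroupoid (G X : Type*) [TopologicalSpace G] [TopologicalSpace X] where
  r : G → X
  s : G → X
  unit : X → G
  inv : G → G
  mul : ∀ γ η : G, s γ = r η → G
  r_unit : ∀ x, r (unit x) = x
  s_unit : ∀ x, s (unit x) = x
  r_inv : ∀ γ, r (inv γ) = s γ
  s_inv : ∀ γ, s (inv γ) = r γ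
  r_mul : ∀ γ η h, r (mul γ η h) = r γ
  s_mul : ∀ γ η h, s (mul γ η h) = s η
  mul_assoc : ∀ γ η ζ (h₁ : s γ = r η) (h₂ : s η = r ζ),
    mul (mul γ η h₁) ζ ((s_mul γ η h₁).trans h₂) = mul γ (mul η ζ h₂) (h₁.trans (r_mul η ζ h₂).symm)
  unit_mul : ∀ γ, mul (unit (r γ)) γ (s_unit (r γ)) = γ
  mul_unit : ∀ γ, mul γ (unit (s γ)) (r_unit (s γ)).symm = γ
  inv_mul : ∀ γ, mul (inv γ) γ (s_inv γ) = unit (s γ)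
  mul_inv : ∀ γ, mul γ (inv γ) (r_inv γ).symm = unit (r γ)
  continuous_r : Continuous r
  continuous_s : Continuous s
  continuous_unit : Continuous unit
  continuous_inv : Continuous inv
  continuous_mul : Continuous fun w : {w : G × G // s w.1 = r w.2} => mul w.1.1 w.1.2 w.2

/-- A (left) Haar system: a family of measures of full support on the range fibres `r ⁻¹ {x}`,
continuous in `x` and invariant under left translation.  The spaces below are always locally
compact, Hausdorff and second countable, so that a Borel measure which is finite on compact sets is
a Radon measure. -/
structure HaarSystem {G X : Type*} [TopologicalSpace G] [TopologicalSpace X] [MeasurableSpace G]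
    (Γ : TopologicalGroupoid G X) where
  measure : ∀ x : X, Measure {η : G // Γ.r η = x}
  finite_on_compacts : ∀ x, IsFiniteMeasureOnCompacts (measure x)
  full_support : ∀ x, (measure x).IsOpenPosMeasure
  continuous_integral : ∀ f : G → ℝ, Continuous f → HasCompactSupport f →
    Continuous fun x => ∫ η, f η.1 ∂(measure x)
  map_mul_left : ∀ γ : G,
    (measure (Γ.s γ)).map
      (fun η : {η : G // Γ.r η = Γ.s γ} =>
        (⟨Γ.mul γ η.1 η.2.symm, Γ.r_mul γ η.1 η.2.symm⟩ : {η : G // Γ.r η = Γ.r γ})) =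
      measure (Γ.r γ)

/-! ## Groupoid actions on spaces and equivalences -/

/-- A continuous left action of a groupoid on a space `Z`, with anchor map `r : Z → X`. -/
structure GroupoidLeftAction {G X : Type*} [TopologicalSpace G] [TopologicalSpace X]
    (Γ : TopologicalGroupoid G X) (Z : Type*) [TopologicalSpace Z] where
  r : Z → X
  act : ∀ (γ : G) (z : Z), Γ.s γ = r z → Z
  r_act : ∀ γ z h, r (act γ z h) = Γ.r γ
  unit_act : ∀ z, act (Γ.unit (r z)) z (Γ.s_unit (r z)) = z
  mul_act : ∀ γ η z (h₁ : Γ.s γ = Γ.r η) (h₂ : Γ.s η = r z),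
    act (Γ.mul γ η h₁) z ((Γ.s_mul γ η h₁).trans h₂) = act γ (act η z h₂) (h₁.trans (r_act η z h₂).symm)
  continuous_r : Continuous r
  continuous_act : Continuous fun w : {w : G × Z // Γ.s w.1 = r w.2} => act w.1.1 w.1.2 w.2

/-- A continuous right action of a groupoid on a space `Z`, with anchor map `s : Z → Y`. -/
structure GroupoidRightAction {H Y : Type*} [TopologicalSpace H] [TopologicalSpace Y]
    (Δ : TopologicalGroupoid H Y) (Z : Type*) [TopologicalSpace Z] where
  s : Z → Y
  act : ∀ (z : Z) (η : H), s z = Δ.r η → Z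
  s_act : ∀ z η h, s (act z η h) = Δ.s η
  act_unit : ∀ z, act z (Δ.unit (s z)) (Δ.r_unit (s z)).symm = z
  act_mul : ∀ z η ζ (h₁ : s z = Δ.r η) (h₂ : Δ.s η = Δ.r ζ),
    act z (Δ.mul η ζ h₂) (h₁.trans (Δ.r_mul η ζ h₂).symm) = act (act z η h₁) ζ ((s_act z η h₁).trans h₂)
  continuous_s : Continuous s
  continuous_act : Continuous fun w : {w : Z × H // s w.1 = Δ.r w.2} => act w.1.1 w.1.2 w.2

namespace GroupoidLeftAction

variable {G X : Type*} [TopologicalSpace G] [TopologicalSpace X]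
  {Γ : TopologicalGroupoid G X} {Z : Type*} [TopologicalSpace Z] (L : GroupoidLeftAction Γ Z)

theorem act_congr {γ γ' : G} {z z' : Z} (hγ : γ = γ') (hz : z = z') (h : Γ.s γ = L.r z) :
    L.act γ z h = L.act γ' z' (by rw [← hγ, ← hz, h]) := by
  subst hγ hz; rfl

theorem inv_act (γ : G) (z : Z) (h : Γ.s γ = L.r z) :
    L.act (Γ.inv γ) (L.act γ z h) ((Γ.s_inv γ).trans (L.r_act γ z h).symm) = z := by
  rw [← L.mul_act (Γ.inv γ) γ z (Γ.s_inv γ) h]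
  rw [L.act_congr ((Γ.inv_mul γ).trans (congrArg Γ.unit h)) rfl, L.unit_act]

/-- The equivalence relation on `Z` whose classes are the orbits of the action. -/
def orbitRel : Setoid Z where
  r z z' := ∃ (γ : G) (h : Γ.s γ = L.r z), L.act γ z h = z'
  iseqv := {
    refl := fun z => ⟨Γ.unit (L.r z), Γ.s_unit _, L.unit_act z⟩
    symm := by
      rintro z z' ⟨γ, h, rfl⟩
      exact ⟨Γ.inv γ, (Γ.s_inv γ).trans (L.r_act γ z h).symm, L.inv_act γ z h⟩
    trans := by
      rintro z z' z'' ⟨γ, h, rfl⟩ ⟨η, h', rfl⟩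
      have h₁ : Γ.s η = Γ.r γ := h'.trans (L.r_act γ z h)
      exact ⟨Γ.mul η γ h₁, (Γ.s_mul η γ h₁).trans h, L.mul_act η γ z h₁ h⟩ }

/-- The action is free if an arrow which fixes some point is a unit. -/
def IsFree : Prop :=
  ∀ (γ : G) (z : Z) (h : Γ.s γ = L.r z), L.act γ z h = z → γ ∈ range Γ.unit

/-- The action is proper if `(γ, z) ↦ (γ z, z)` is a proper map. -/
def IsProper : Prop :=
  IsProperMap fun w : {w : G × Z // Γ.s w.1 = L.r w.2} => (L.act w.1.1 w.1.2 w.2, w.1.2)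

end GroupoidLeftAction

namespace GroupoidRightAction

variable {H Y : Type*} [TopologicalSpace H] [TopologicalSpace Y]
  {Δ : TopologicalGroupoid H Y} {Z : Type*} [TopologicalSpace Z] (R : GroupoidRightAction Δ Z)

theorem act_congr {η η' : H} {z z' : Z} (hη : η = η') (hz : z = z') (h : R.s z = Δ.r η) :
    R.act z η h = R.act z' η' (by rw [← hη, ← hz, h]) := by
  subst hη hz; rfl

theorem act_inv (z : Z) (η : H) (h : R.s z = Δ.r η) :
    R.act (R.act z η h) (Δ.inv η) ((R.s_act z η h).trans (Δ.r_inv η).symm) = z := by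
  rw [← R.act_mul z η (Δ.inv η) h (Δ.r_inv η).symm]
  rw [R.act_congr ((Δ.mul_inv η).trans (congrArg Δ.unit h.symm)) rfl, R.act_unit]

/-- The equivalence relation on `Z` whose classes are the orbits of the action. -/
def orbitRel : Setoid Z where
  r z z' := ∃ (η : H) (h : R.s z = Δ.r η), R.act z η h = z'
  iseqv := {
    refl := fun z => ⟨Δ.unit (R.s z), (Δ.r_unit _).symm, R.act_unit z⟩
    symm := by
      rintro z z' ⟨η, h, rfl⟩
      exact ⟨Δ.inv η, (R.s_act z η h).trans (Δ.r_inv η).symm, R.act_inv z η h⟩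
    trans := by
      rintro z z' z'' ⟨η, h, rfl⟩ ⟨ζ, h', rfl⟩
      have h₂ : Δ.s η = Δ.r ζ := (R.s_act z η h).symm.trans h'
      exact ⟨Δ.mul η ζ h₂, h.trans (Δ.r_mul η ζ h₂).symm, R.act_mul z η ζ h h₂⟩ }

/-- The action is free if an arrow which fixes some point is a unit. -/
def IsFree : Prop :=
  ∀ (z : Z) (η : H) (h : R.s z = Δ.r η), R.act z η h = z → η ∈ range Δ.unit

/-- The action is proper if `(z, η) ↦ (z η, z)` is a proper map. -/
def IsProper : Prop :=
  IsProperMap fun w : {w : Z × H // R.s w.1 = Δ.r w.2} => (R.act w.1.1 w.1.2 w.2, w.1.1)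

end GroupoidRightAction

/-- The structure of a `(𝒢, ℋ)`-equivalence on a space `Z`: commuting free and proper actions of
`𝒢` (on the left) and of `ℋ` (on the right), with open surjective anchor maps `r` and `s` which
descend to homeomorphisms `Z / ℋ ≅ 𝒢⁽⁰⁾` and `𝒢 \ Z ≅ ℋ⁽⁰⁾`. -/
structure GroupoidEquivalence {G X H Y : Type*} [TopologicalSpace G] [TopologicalSpace X]
    [TopologicalSpace H] [TopologicalSpace Y] (Γ : TopologicalGroupoid G X)
    (Δ : TopologicalGroupoid H Y) (Z : Type*) [TopologicalSpace Z] where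
  left : GroupoidLeftAction Γ Z
  right : GroupoidRightAction Δ Z
  isOpenMap_r : IsOpenMap left.r
  surjective_r : Function.Surjective left.r
  isOpenMap_s : IsOpenMap right.s
  surjective_s : Function.Surjective right.s
  s_act_left : ∀ γ z h, right.s (left.act γ z h) = right.s z
  r_act_right : ∀ z η h, left.r (right.act z η h) = left.r z
  act_comm : ∀ γ z η (h₁ : Γ.s γ = left.r z) (h₂ : right.s z = Δ.r η),
    right.act (left.act γ z h₁) η ((s_act_left γ z h₁).trans h₂) =
      left.act γ (right.act z η h₂) (h₁.trans (r_act_right z η h₂).symm)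
  left_free : left.IsFree
  left_proper : left.IsProper
  right_free : right.IsFree
  right_proper : right.IsProper
  isHomeomorph_s : IsHomeomorph
    (Quotient.lift (s := left.orbitRel) right.s
      (by rintro z _ ⟨γ, h, rfl⟩; exact (s_act_left γ z h).symm))
  isHomeomorph_r : IsHomeomorph
    (Quotient.lift (s := right.orbitRel) left.r
      (by rintro z _ ⟨η, h, rfl⟩; exact (r_act_right z η h).symm))

/-! ## Upper semi-continuous bundles of C*-algebras -/

/-- The fibre of `p : A → X` over `x`.  It is a type of its own (and not a subtype of `A`), because
in a bundle of C*-algebras it carries the topology of its norm by definition. -/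
@[ext]
structure Fibre {A X : Type*} (p : A → X) (x : X) where
  pt : A
  proj_pt : p pt = x

/-- An upper semi-continuous bundle of C*-algebras over `X` with total space `A`. -/
structure CStarBundle (X A : Type*) [TopologicalSpace X] [TopologicalSpace A] where
  proj : A → X
  [fibreCStar : ∀ x, NonUnitalCStarAlgebra (Fibre proj x)]
  continuous_proj : Continuous proj
  isOpenMap_proj : IsOpenMap proj
  surjective_proj : Function.Surjective proj
  upperSemicontinuous_norm : UpperSemicontinuous fun a : A => ‖(⟨a, rfl⟩ : Fibre proj (proj a))‖
  continuous_add : Continuous fun w : {w : A × A // proj w.2 = proj w.1} =>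
    ((⟨w.1.1, rfl⟩ + ⟨w.1.2, w.2⟩ : Fibre proj (proj w.1.1))).pt
  continuous_mul : Continuous fun w : {w : A × A // proj w.2 = proj w.1} =>
    ((⟨w.1.1, rfl⟩ * ⟨w.1.2, w.2⟩ : Fibre proj (proj w.1.1))).pt
  continuous_smul : ∀ c : ℂ, Continuous fun a : A => (c • (⟨a, rfl⟩ : Fibre proj (proj a))).pt
  continuous_star : Continuous fun a : A => (star (⟨a, rfl⟩ : Fibre proj (proj a))).pt
  /-- If `proj aᵢ → x` and `‖aᵢ‖ → 0` along a net `aᵢ`, then `aᵢ → 0ₓ`. -/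
  tendsto_zero : ∀ x : X,
    comap proj (𝓝 x) ⊓ comap (fun a : A => ‖(⟨a, rfl⟩ : Fibre proj (proj a))‖) (𝓝 0) ≤
      𝓝 (0 : Fibre proj x).pt

namespace CStarBundle

variable {X A : Type*} [TopologicalSpace X] [TopologicalSpace A]

instance (𝒜 : CStarBundle X A) (x : X) : NonUnitalCStarAlgebra (Fibre 𝒜.proj x) :=
  𝒜.fibreCStar x

/-- The bundle has enough sections: every element of every fibre is the value of a continuous
section of compact support. -/
def HasEnoughSections (𝒜 : CStarBundle X A) : Prop :=
  ∀ (x : X) (a : Fibre 𝒜.proj x), ∃ (f : X → A) (hf : ∀ y, 𝒜.proj (f y) = y),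
    Continuous f ∧
    IsCompact (closure {y : X | (⟨f y, hf y⟩ : Fibre 𝒜.proj y) ≠ 0}) ∧
    (⟨f x, hf x⟩ : Fibre 𝒜.proj x) = a

end CStarBundle

/-! ## Groupoid dynamical systems -/

/-- A groupoid dynamical system `(𝒜, 𝒢, α)`: an action of `𝒢` on the bundle `𝒜` over `𝒢⁽⁰⁾` by
`*`-isomorphisms `α γ : A_{s(γ)} → A_{r(γ)}` of the fibres. -/
structure GroupoidDynamicalSystem {G X A : Type*} [TopologicalSpace G] [TopologicalSpace X]
    [TopologicalSpace A] (Γ : TopologicalGroupoid G X) (𝒜 : CStarBundle X A) where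
  α : ∀ γ : G, Fibre 𝒜.proj (Γ.s γ) ≃⋆ₐ[ℂ] Fibre 𝒜.proj (Γ.r γ)
  α_mul : ∀ (γ η : G) (h : Γ.s γ = Γ.r η) (a : A) (ha : 𝒜.proj a = Γ.s η),
    (α (Γ.mul γ η h) ⟨a, ha.trans (Γ.s_mul γ η h).symm⟩).pt =
      (α γ ⟨(α η ⟨a, ha⟩).pt, (α η ⟨a, ha⟩).proj_pt.trans h.symm⟩).pt
  α_inv : ∀ (γ : G) (a : Fibre 𝒜.proj (Γ.r γ)),
    (α (Γ.inv γ) ⟨a.pt, a.proj_pt.trans (Γ.s_inv γ).symm⟩).pt = ((α γ).symm a).pt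
  continuous_α : Continuous fun w : {w : G × A // 𝒜.proj w.2 = Γ.s w.1} =>
    (α w.1.1 ⟨w.1.2, w.2⟩).pt

namespace GroupoidDynamicalSystem

variable {G X A : Type*} [TopologicalSpace G] [TopologicalSpace X]
  [TopologicalSpace A] {Γ : TopologicalGroupoid G X} {𝒜 : CStarBundle X A}
  (D : GroupoidDynamicalSystem Γ 𝒜)

theorem α_congr {γ γ' : G} {a a' : A} (hγ : γ = γ') (ha : a = a') (h : 𝒜.proj a = Γ.s γ) :
    (D.α γ ⟨a, h⟩).pt = (D.α γ' ⟨a', by rw [← ha, ← hγ, h]⟩).pt := by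
  subst hγ ha; rfl

theorem α_unit (x : X) (a : A) (ha : 𝒜.proj a = Γ.s (Γ.unit x)) :
    (D.α (Γ.unit x) ⟨a, ha⟩).pt = a := by
  have hx : Γ.s (Γ.unit x) = Γ.r (Γ.unit x) := (Γ.s_unit x).trans (Γ.r_unit x).symm
  have h1 := D.α_mul (Γ.unit x) (Γ.unit x) hx a ha
  have e : Γ.mul (Γ.unit x) (Γ.unit x) hx = Γ.unit x := by
    have key : ∀ u (hu : Γ.s u = Γ.r (Γ.unit x)), u = Γ.unit (Γ.r (Γ.unit x)) →
        Γ.mul u (Γ.unit x) hu = Γ.unit x := by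
      rintro u hu rfl; exact Γ.unit_mul _
    exact key _ hx (by rw [Γ.r_unit])
  rw [D.α_congr e rfl] at h1
  have h2 : (⟨a, ha⟩ : Fibre 𝒜.proj (Γ.s (Γ.unit x))) =
      ⟨(D.α (Γ.unit x) ⟨a, ha⟩).pt, (D.α (Γ.unit x) ⟨a, ha⟩).proj_pt.trans hx.symm⟩ :=
    (D.α (Γ.unit x)).injective (Fibre.ext h1)
  exact (congrArg Fibre.pt h2).symm

theorem norm_α (γ : G) (a : Fibre 𝒜.proj (Γ.s γ)) : ‖D.α γ a‖ = ‖a‖ :=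
  NonUnitalStarAlgHom.norm_map (D.α γ) (D.α γ).injective a

/-- The pull-back `r^* 𝒜 = {(z, a) | a ∈ A_{r(z)}}` along the anchor map of a left action. -/
abbrev Pullback {Z : Type*} [TopologicalSpace Z] (_D : GroupoidDynamicalSystem Γ 𝒜)
    (L : GroupoidLeftAction Γ Z) : Type _ :=
  {w : Z × A // 𝒜.proj w.2 = L.r w.1}

variable {Z : Type*} [TopologicalSpace Z] (L : GroupoidLeftAction Γ Z)

/-- The action `γ (z, a) = (γ z, α_γ(a))` of `𝒢` on `r^* 𝒜`. -/
def pullbackAction : GroupoidLeftAction Γ (D.Pullback L) where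
  r w := L.r w.1.1
  act γ w h := ⟨(L.act γ w.1.1 h, (D.α γ ⟨w.1.2, w.2.trans h.symm⟩).pt),
    (D.α γ ⟨w.1.2, w.2.trans h.symm⟩).proj_pt.trans (L.r_act γ w.1.1 h).symm⟩
  r_act γ w h := L.r_act γ w.1.1 h
  unit_act w := Subtype.ext (Prod.ext (L.unit_act w.1.1) (D.α_unit _ _ _))
  mul_act γ η w h₁ h₂ := Subtype.ext (Prod.ext (L.mul_act γ η w.1.1 h₁ h₂)
    (D.α_mul γ η h₁ w.1.2 (w.2.trans h₂.symm)))
  continuous_r := L.continuous_r.comp (continuous_fst.comp continuous_subtype_val)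
  continuous_act := by
    refine Continuous.subtype_mk (Continuous.prodMk ?_ ?_) _
    · exact L.continuous_act.comp (Continuous.subtype_mk (f := fun w : {w : G × D.Pullback L //
        Γ.s w.1 = L.r w.2.1.1} => (w.1.1, w.1.2.1.1)) (by fun_prop) fun w => w.2)
    · exact D.continuous_α.comp (Continuous.subtype_mk (f := fun w : {w : G × D.Pullback L //
        Γ.s w.1 = L.r w.2.1.1} => (w.1.1, w.1.2.1.2)) (by fun_prop)
        fun w => w.1.2.2.trans w.2.symm)

end GroupoidDynamicalSystem

/-! ## The basic construction -/

/-- Transport of the structure of a C*-algebra along a bijection. -/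
@[reducible]
def Equiv.nonUnitalCStarAlgebra {E F : Type*} (e : F ≃ E) [NonUnitalCStarAlgebra E] :
    NonUnitalCStarAlgebra F := by
  letI i1 : NonUnitalRing F := e.nonUnitalRing
  letI i2 : Module ℂ F := e.module ℂ
  let f : F →ₙ+* E :=
    { toFun := e
      map_mul' := fun x y => e.apply_symm_apply _
      map_zero' := e.apply_symm_apply _
      map_add' := fun x y => e.apply_symm_apply _ }
  letI i3 : NonUnitalNormedRing F := NonUnitalNormedRing.induced F E f e.injective
  have hsmul : ∀ (c : ℂ) (x : F), e (c • x) = c • e x := fun c x => e.apply_symm_apply _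
  have hmul : ∀ (x y : F), e (x * y) = e x * e y := fun x y => e.apply_symm_apply _
  have hadd : ∀ (x y : F), e (x + y) = e x + e y := fun x y => e.apply_symm_apply _
  have hnorm : ∀ x : F, ‖x‖ = ‖e x‖ := fun _ => rfl
  letI i4 : Star F := ⟨fun x => e.symm (star (e x))⟩
  have hstar : ∀ x : F, e (star x) = star (e x) := fun x => e.apply_symm_apply _
  letI i5 : StarRing F :=
    { star_involutive := fun x => e.injective (by rw [hstar, hstar, star_star])
      star_mul := fun x y => e.injective (by rw [hstar, hmul, hmul, hstar, hstar, star_mul])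
      star_add := fun x y => e.injective (by rw [hstar, hadd, hadd, hstar, hstar, star_add]) }
  letI i6 : NormedSpace ℂ F :=
    { norm_smul_le := fun c x => by rw [hnorm, hsmul, hnorm]; exact norm_smul_le c (e x) }
  have hiso : Isometry e := AddMonoidHomClass.isometry_of_norm f fun x => (hnorm x).symm
  exact
    { complete := by
        have : CompleteSpace F := by
          rw [completeSpace_congr (e := e) hiso.isUniformEmbedding]; infer_instance
        exact fun {f} hf => this.complete hf
      norm_mul_self_le := fun x => by
        rw [hnorm, hnorm, hmul, hstar]; exact CStarRing.norm_mul_self_le (e x)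
      smul_assoc := fun c x y => e.injective (by
        simp only [smul_eq_mul, hsmul, hmul]; exact smul_mul_assoc c _ _)
      smul_comm := fun c x y => e.injective (by
        simp only [smul_eq_mul, hsmul, hmul]; exact (mul_smul_comm c _ _).symm)
      star_smul := fun c x => e.injective (by
        rw [hstar, hsmul, hsmul, hstar, star_smul]) }

theorem isOpenMap_fibreProduct_snd {Z P Y : Type*} [TopologicalSpace Z] [TopologicalSpace P]
    [TopologicalSpace Y] {f : Z → Y} {g : P → Y} (hf : IsOpenMap f) (hg : Continuous g) :
    IsOpenMap fun t : {t : Z × P // f t.1 = g t.2} => t.1.2 := by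
  rw [isOpenMap_iff_nhds_le]
  rintro ⟨⟨z, p⟩, h⟩ s hs
  rw [mem_map, nhds_subtype_eq_comap, mem_comap] at hs
  obtain ⟨t, ht, hts⟩ := hs
  obtain ⟨V, hV, W, hW, hVW⟩ := mem_nhds_prod_iff.1 ht
  have h1 : f '' V ∈ 𝓝 (g p) := by
    have := hf.image_mem_nhds hV
    rwa [show f z = g p from h] at this
  filter_upwards [hW, hg.continuousAt h1] with p' hp' hp''
  obtain ⟨z', hz', e⟩ := hp''
  exact hts (a := ⟨(z', p'), e⟩) (hVW ⟨hz', hp'⟩)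

namespace TopologicalGroupoid

variable {G X : Type*} [TopologicalSpace G] [TopologicalSpace X] (Γ : TopologicalGroupoid G X)

theorem mul_congr {γ γ' η η' : G} (h₁ : γ = γ') (h₂ : η = η') (h : Γ.s γ = Γ.r η) :
    Γ.mul γ η h = Γ.mul γ' η' (by rw [← h₁, ← h₂, h]) := by
  subst h₁ h₂; rfl

theorem eq_of_inv_mul_eq_unit {γ γ' : G} {x : X} (h : Γ.s (Γ.inv γ') = Γ.r γ)
    (e : Γ.mul (Γ.inv γ') γ h = Γ.unit x) : γ = γ' := by
  have hx : x = Γ.s γ' := by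
    have := congrArg Γ.r e
    rw [Γ.r_mul, Γ.r_inv, Γ.r_unit] at this
    exact this.symm
  subst hx
  have h1 := Γ.mul_assoc γ' (Γ.inv γ') γ (Γ.r_inv γ').symm h
  rw [Γ.mul_congr rfl e, Γ.mul_unit,
    Γ.mul_congr ((Γ.mul_inv γ').trans (congrArg Γ.unit ((Γ.s_inv γ').symm.trans h))) rfl,
    Γ.unit_mul] at h1
  exact h1

end TopologicalGroupoid

namespace Fibre

variable {X A : Type*} [TopologicalSpace X] [TopologicalSpace A]

/-- The identity map between the fibres over equal points. -/
def cast (𝒜 : CStarBundle X A) {x y : X} (h : x = y) :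
    Fibre 𝒜.proj x ≃⋆ₐ[ℂ] Fibre 𝒜.proj y := by
  subst h; exact StarAlgEquiv.refl ℂ _

theorem cast_pt (𝒜 : CStarBundle X A) {x y : X} (h : x = y) (a : Fibre 𝒜.proj x) :
    (cast 𝒜 h a).pt = a.pt := by
  subst h; rfl

end Fibre

namespace GroupoidEquivalence

variable {G X H Y Z A : Type*} [TopologicalSpace G] [TopologicalSpace X]
  [TopologicalSpace H] [TopologicalSpace Y] [TopologicalSpace Z] [TopologicalSpace A]
  {Γ : TopologicalGroupoid G X} {Δ : TopologicalGroupoid H Y} (E : GroupoidEquivalence Γ Δ Z)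
  {𝒜 : CStarBundle X A} (D : GroupoidDynamicalSystem Γ 𝒜)

theorem exists_act_eq {z w : Z} (h : E.right.s z = E.right.s w) :
    ∃ (γ : G) (hγ : Γ.s γ = E.left.r z), E.left.act γ z hγ = w :=
  letI := E.left.orbitRel
  Quotient.exact (E.isHomeomorph_s.injective (a₁ := ⟦z⟧) (a₂ := ⟦w⟧) h)

theorem isClosedEmbedding_act : IsClosedEmbedding
    fun w : {w : G × Z // Γ.s w.1 = E.left.r w.2} => (E.left.act w.1.1 w.1.2 w.2, w.1.2) := by
  refine .of_continuous_injective_isClosedMap E.left_proper.continuous ?_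
    E.left_proper.isClosedMap
  rintro ⟨⟨γ, z⟩, h⟩ ⟨⟨γ', z'⟩, h'⟩ e
  simp only [Prod.mk.injEq] at e
  obtain ⟨e, rfl⟩ := e
  have hr : Γ.r γ = Γ.r γ' := by rw [← E.left.r_act γ z h, e, E.left.r_act]
  have hm : Γ.s (Γ.inv γ') = Γ.r γ := (Γ.s_inv γ').trans hr.symm
  have h2 : E.left.act (Γ.mul (Γ.inv γ') γ hm) z ((Γ.s_mul _ _ hm).trans h) = z := by
    rw [E.left.mul_act (Γ.inv γ') γ z hm h, E.left.act_congr rfl e, E.left.inv_act]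
  obtain ⟨x, hx⟩ := E.left_free _ _ _ h2
  have := Γ.eq_of_inv_mul_eq_unit hm hx.symm
  subst this; rfl

/-- The arrow `γ` with `γ w = z`, for `z` and `w` in the same orbit. -/
noncomputable def trans {z w : Z} (h : E.right.s z = E.right.s w) : G :=
  (E.exists_act_eq h.symm).choose

theorem s_trans {z w : Z} (h : E.right.s z = E.right.s w) : Γ.s (E.trans h) = E.left.r w :=
  (E.exists_act_eq h.symm).choose_spec.choose

theorem trans_act {z w : Z} (h : E.right.s z = E.right.s w) :
    E.left.act (E.trans h) w (E.s_trans h) = z :=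
  (E.exists_act_eq h.symm).choose_spec.choose_spec

theorem r_trans {z w : Z} (h : E.right.s z = E.right.s w) : Γ.r (E.trans h) = E.left.r z := by
  rw [← E.left.r_act _ w (E.s_trans h), E.trans_act]

theorem continuous_trans :
    Continuous fun t : {t : Z × Z // E.right.s t.1 = E.right.s t.2} => E.trans t.2 := by
  have h : Continuous fun t : {t : Z × Z // E.right.s t.1 = E.right.s t.2} =>
      (⟨(E.trans t.2, t.1.2), E.s_trans t.2⟩ : {w : G × Z // Γ.s w.1 = E.left.r w.2}) := by
    rw [E.isClosedEmbedding_act.isInducing.continuous_iff]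
    have : ((fun w : {w : G × Z // Γ.s w.1 = E.left.r w.2} =>
        (E.left.act w.1.1 w.1.2 w.2, w.1.2)) ∘
        fun t : {t : Z × Z // E.right.s t.1 = E.right.s t.2} =>
          ⟨(E.trans t.2, t.1.2), E.s_trans t.2⟩) = Subtype.val := by
      funext t
      exact Prod.ext (E.trans_act t.2) rfl
    rw [this]
    exact continuous_subtype_val
  exact (continuous_fst.comp continuous_subtype_val).comp h

/-- The total space `𝒢 \ r^* 𝒜` of the bundle `𝒜_Z`, with the quotient topology. -/
abbrev BasicSpace : Type _ := Quotient (D.pullbackAction E.left).orbitRel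

/-- The class `[(z, a)]` in `𝒢 \ r^* 𝒜`. -/
def toBasic (w : D.Pullback E.left) : E.BasicSpace D := Quotient.mk _ w

/-- The projection `[(z, a)] ↦ s(z)`. -/
def basicProj : E.BasicSpace D → Y :=
  Quotient.lift (fun w => E.right.s w.1.1)
    (by rintro w _ ⟨γ, h, rfl⟩; exact (E.s_act_left γ w.1.1 h).symm)

/-- The map `a ↦ [(z, a)]` from the fibre of `𝒜` over `r(z)` to the fibre of `𝒜_Z` over
`s(z)`. -/
def basicMk {y : Y} (z : Z) (h : E.right.s z = y) (a : Fibre 𝒜.proj (E.left.r z)) :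
    Fibre (E.basicProj D) y :=
  ⟨E.toBasic D ⟨(z, a.pt), a.proj_pt⟩, h⟩

theorem toBasic_eq {z w : Z} (h : E.right.s z = E.right.s w) (a : A) (ha : 𝒜.proj a = E.left.r w) :
    E.toBasic D ⟨(w, a), ha⟩ = E.toBasic D ⟨(z, (D.α (E.trans h) ⟨a, ha.trans (E.s_trans h).symm⟩).pt),
      (D.α (E.trans h) _).proj_pt.trans (E.r_trans h)⟩ :=
  Quotient.sound ⟨E.trans h, E.s_trans h, Subtype.ext (Prod.ext (E.trans_act h) rfl)⟩

theorem basicMk_bijective {y : Y} (z : Z) (h : E.right.s z = y) :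
    Function.Bijective (E.basicMk D z h) := by
  constructor
  · intro a b e
    have e' : E.toBasic D ⟨(z, a.pt), a.proj_pt⟩ = E.toBasic D ⟨(z, b.pt), b.proj_pt⟩ :=
      congrArg Fibre.pt e
    obtain ⟨γ, hγ, e⟩ := Quotient.exact e'
    have e1 : E.left.act γ z hγ = z := congrArg (fun w => w.1.1) e
    have e2 : (D.α γ ⟨a.pt, a.proj_pt.trans hγ.symm⟩).pt = b.pt := congrArg (fun w => w.1.2) e
    obtain ⟨x, rfl⟩ := E.left_free _ _ _ e1
    rw [D.α_unit] at e2
    exact Fibre.ext e2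
  · rintro ⟨c, hc⟩
    induction c using Quotient.inductionOn with
    | h w =>
      obtain ⟨⟨w, a⟩, ha⟩ := w
      have hw : E.right.s z = E.right.s w := h.trans hc.symm
      exact ⟨⟨_, (D.α (E.trans hw) _).proj_pt.trans (E.r_trans hw)⟩,
        Fibre.ext (E.toBasic_eq D hw a ha).symm⟩

/-- The bijection `[(z, a)] ↦ a` from the fibre of `𝒜_Z` over `s(z)` to the fibre of `𝒜` over
`r(z)`. -/
noncomputable def basicEquiv {y : Y} (z : Z) (h : E.right.s z = y) :
    Fibre (E.basicProj D) y ≃ Fibre 𝒜.proj (E.left.r z) :=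
  (Equiv.ofBijective _ (E.basicMk_bijective D z h)).symm

/-- The C*-algebra structure on the fibre of `𝒜_Z` over `y` for which `a ↦ [(z, a)]` is an
isomorphism for one (equivalently, as shown below, for every) point `z` with `s(z) = y`. -/
noncomputable instance basicFibre (y : Y) : NonUnitalCStarAlgebra (Fibre (E.basicProj D) y) :=
  (E.basicEquiv D (Function.surjInv E.surjective_s y)
    (Function.surjInv_eq E.surjective_s y)).nonUnitalCStarAlgebra

/-- Every map `a ↦ [(z, a)]` is, up to the chosen identification, a `*`-isomorphism. -/
theorem exists_basicEquiv_basicMk {y : Y} (z : Z) (h : E.right.s z = y) :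
    ∃ φ : Fibre 𝒜.proj (E.left.r z) ≃⋆ₐ[ℂ]
        Fibre 𝒜.proj (E.left.r (Function.surjInv E.surjective_s y)),
      ∀ a, E.basicEquiv D (Function.surjInv E.surjective_s y)
        (Function.surjInv_eq E.surjective_s y) (E.basicMk D z h a) = φ a := by
  have hz : E.right.s (Function.surjInv E.surjective_s y) = E.right.s z :=
    (Function.surjInv_eq E.surjective_s y).trans h.symm
  refine ⟨((Fibre.cast 𝒜 (E.s_trans hz).symm).trans (D.α (E.trans hz))).trans
    (Fibre.cast 𝒜 (E.r_trans hz)), fun a => ?_⟩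
  rw [basicEquiv, Equiv.symm_apply_eq]
  refine Fibre.ext ((E.toBasic_eq D hz a.pt a.proj_pt).trans ?_)
  refine congrArg (E.toBasic D) (Subtype.ext (Prod.ext rfl ?_))
  simp only [StarAlgEquiv.trans_apply]
  rw [Fibre.cast_pt]
  congr 2
  exact Fibre.ext (Fibre.cast_pt 𝒜 _ a).symm

section operations

variable {y : Y} (z : Z) (h : E.right.s z = y)

theorem basicMk_add (a b : Fibre 𝒜.proj (E.left.r z)) :
    E.basicMk D z h (a + b) = E.basicMk D z h a + E.basicMk D z h b := by
  obtain ⟨φ, hφ⟩ := E.exists_basicEquiv_basicMk D z h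
  refine (Equiv.eq_symm_apply (E.basicEquiv D _ (Function.surjInv_eq E.surjective_s y))).2 ?_
  rw [hφ]
  exact (map_add φ a b).trans (congrArg₂ (· + ·) (hφ a).symm (hφ b).symm)

theorem basicMk_mul (a b : Fibre 𝒜.proj (E.left.r z)) :
    E.basicMk D z h (a * b) = E.basicMk D z h a * E.basicMk D z h b := by
  obtain ⟨φ, hφ⟩ := E.exists_basicEquiv_basicMk D z h
  refine (Equiv.eq_symm_apply (E.basicEquiv D _ (Function.surjInv_eq E.surjective_s y))).2 ?_
  rw [hφ]
  exact (map_mul φ a b).trans (congrArg₂ (· * ·) (hφ a).symm (hφ b).symm)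

theorem basicMk_smul (c : ℂ) (a : Fibre 𝒜.proj (E.left.r z)) :
    E.basicMk D z h (c • a) = c • E.basicMk D z h a := by
  obtain ⟨φ, hφ⟩ := E.exists_basicEquiv_basicMk D z h
  refine (Equiv.eq_symm_apply (E.basicEquiv D _ (Function.surjInv_eq E.surjective_s y))).2 ?_
  rw [hφ]
  exact (map_smul φ c a).trans (congrArg (c • ·) (hφ a).symm)

theorem basicMk_star (a : Fibre 𝒜.proj (E.left.r z)) :
    E.basicMk D z h (star a) = star (E.basicMk D z h a) := by
  obtain ⟨φ, hφ⟩ := E.exists_basicEquiv_basicMk D z h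
  refine (Equiv.eq_symm_apply (E.basicEquiv D _ (Function.surjInv_eq E.surjective_s y))).2 ?_
  rw [hφ, hφ, map_star]

theorem basicMk_zero : E.basicMk D z h 0 = 0 := by
  obtain ⟨φ, hφ⟩ := E.exists_basicEquiv_basicMk D z h
  refine (Equiv.eq_symm_apply (E.basicEquiv D _ (Function.surjInv_eq E.surjective_s y))).2 ?_
  rw [hφ, map_zero]

theorem norm_basicMk (a : Fibre 𝒜.proj (E.left.r z)) : ‖E.basicMk D z h a‖ = ‖a‖ := by
  obtain ⟨φ, hφ⟩ := E.exists_basicEquiv_basicMk D z h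
  change ‖E.basicEquiv D _ _ (E.basicMk D z h a)‖ = _
  rw [hφ]
  exact NonUnitalStarAlgHom.norm_map φ φ.injective a

end operations

theorem continuous_toBasic : Continuous (E.toBasic D) := continuous_quotient_mk'

theorem surjective_toBasic : Function.Surjective (E.toBasic D) := Quotient.mk_surjective

theorem continuous_basicProj : Continuous (E.basicProj D) :=
  Continuous.quotient_lift (E.right.continuous_s.comp
    (continuous_fst.comp continuous_subtype_val)) _

/-- Moving the point `(w, b)` of `r^* 𝒜` along its orbit to the fibre over `z`. -/
theorem continuous_move : Continuous
    fun t : {t : Z × D.Pullback E.left // E.right.s t.1 = E.right.s t.2.1.1} =>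
      (⟨(t.1.1, (D.α (E.trans t.2) ⟨t.1.2.1.2, t.1.2.2.trans (E.s_trans t.2).symm⟩).pt),
        (D.α (E.trans t.2) _).proj_pt.trans (E.r_trans t.2)⟩ : D.Pullback E.left) := by
  have h0 : Continuous fun t : {t : Z × D.Pullback E.left // E.right.s t.1 = E.right.s t.2.1.1} =>
      E.trans t.2 :=
    E.continuous_trans.comp (Continuous.subtype_mk (f := fun t : {t : Z × D.Pullback E.left //
      E.right.s t.1 = E.right.s t.2.1.1} => (t.1.1, t.1.2.1.1)) (by fun_prop) fun t => t.2)
  refine Continuous.subtype_mk (Continuous.prodMk (by fun_prop) ?_) _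
  exact D.continuous_α.comp (Continuous.subtype_mk (f := fun t : {t : Z × D.Pullback E.left //
    E.right.s t.1 = E.right.s t.2.1.1} => (E.trans t.2, t.1.2.1.2)) (h0.prodMk (by fun_prop))
      fun t => t.1.2.2.trans (E.s_trans t.2).symm)

theorem isOpenMap_toBasic : IsOpenMap (E.toBasic D) := by
  intro U hU
  change IsOpen (E.toBasic D ⁻¹' (E.toBasic D '' U))
  have h1 := isOpenMap_fibreProduct_snd (P := D.Pullback E.left)
    (g := fun w => E.right.s w.1.1) E.isOpenMap_s
    (E.right.continuous_s.comp (continuous_fst.comp continuous_subtype_val)) _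
    (hU.preimage (E.continuous_move D))
  convert h1 using 1
  ext w
  constructor
  · rintro ⟨u, hu, e⟩
    obtain ⟨⟨w, b⟩, hb⟩ := w
    obtain ⟨⟨z, a⟩, ha⟩ := u
    have hzw : E.right.s z = E.right.s w := congrArg (E.basicProj D) e
    refine ⟨⟨(z, ⟨(w, b), hb⟩), hzw⟩, ?_, rfl⟩
    have e2 := e.trans (E.toBasic_eq D hzw b hb)
    have e3 := (E.basicMk_bijective D z rfl).injective (a₁ := ⟨a, ha⟩)
      (a₂ := ⟨_, (D.α (E.trans hzw) _).proj_pt.trans (E.r_trans hzw)⟩) (Fibre.ext e2)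
    have e4 := congrArg Fibre.pt e3
    have e5 : (⟨(z, a), ha⟩ : D.Pullback E.left) = ⟨(z, _),
        (D.α (E.trans hzw) ⟨b, hb.trans (E.s_trans hzw).symm⟩).proj_pt.trans (E.r_trans hzw)⟩ :=
      Subtype.ext (Prod.ext rfl e4)
    rw [e5] at hu
    exact hu
  · rintro ⟨⟨⟨z, ⟨⟨w, b⟩, hb⟩⟩, hzw⟩, ht, rfl⟩
    exact ⟨_, ht, (E.toBasic_eq D hzw b hb).symm⟩

theorem isOpenQuotientMap_toBasic : IsOpenQuotientMap (E.toBasic D) :=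
  ⟨E.surjective_toBasic D, E.continuous_toBasic D, E.isOpenMap_toBasic D⟩

theorem isOpenQuotientMap_toBasic_toBasic : IsOpenQuotientMap
    ({w : E.BasicSpace D × E.BasicSpace D | E.basicProj D w.2 = E.basicProj D w.1}.restrictPreimage
      (Prod.map (E.toBasic D) (E.toBasic D))) := by
  have h := (E.isOpenQuotientMap_toBasic D).prodMap (E.isOpenQuotientMap_toBasic D)
  exact ⟨h.surjective.restrictPreimage _, h.continuous.restrictPreimage,
    h.isOpenMap.restrictPreimage _⟩

theorem isOpenMap_pullback_fst : IsOpenMap fun w : D.Pullback E.left => w.1.1 := by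
  intro U hU
  have h := isOpenMap_fibreProduct_snd 𝒜.isOpenMap_proj E.left.continuous_r _
    (hU.preimage (f := fun t : {t : A × Z // 𝒜.proj t.1 = E.left.r t.2} =>
      (⟨(t.1.2, t.1.1), t.2⟩ : D.Pullback E.left)) (by fun_prop))
  convert h using 1
  ext z
  constructor
  · rintro ⟨⟨⟨z, a⟩, ha⟩, hw, rfl⟩
    exact ⟨⟨(a, z), ha⟩, hw, rfl⟩
  · rintro ⟨⟨⟨a, z⟩, ha⟩, hw, rfl⟩
    exact ⟨⟨(z, a), ha⟩, hw, rfl⟩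

/-- The norm `‖[(z, a)]‖ = ‖a‖` on the total space of `𝒜_Z`. -/
theorem norm_toBasic (w : D.Pullback E.left) :
    ‖(⟨E.toBasic D w, rfl⟩ : Fibre (E.basicProj D) (E.basicProj D (E.toBasic D w)))‖ =
      ‖(⟨w.1.2, rfl⟩ : Fibre 𝒜.proj (𝒜.proj w.1.2))‖ := by
  have key : ∀ (a : A) (x : X) (h : 𝒜.proj a = x),
      ‖(⟨a, h⟩ : Fibre 𝒜.proj x)‖ = ‖(⟨a, rfl⟩ : Fibre 𝒜.proj (𝒜.proj a))‖ := by
    rintro a _ rfl; rfl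
  exact (E.norm_basicMk D w.1.1 rfl ⟨w.1.2, w.2⟩).trans (key _ _ _)

/-- Two elements of the same fibre of `𝒜_Z` are represented over the same point of `Z`. -/
theorem continuous_pair : Continuous
    fun t : (Prod.map (E.toBasic D) (E.toBasic D) ⁻¹'
        {w : E.BasicSpace D × E.BasicSpace D | E.basicProj D w.2 = E.basicProj D w.1}) =>
      (⟨(t.1.1.1.2, (D.α (E.trans (z := t.1.1.1.1) (w := t.1.2.1.1) t.2.symm)
          ⟨t.1.2.1.2, t.1.2.2.trans (E.s_trans _).symm⟩).pt),
        ((D.α _ _).proj_pt.trans (E.r_trans _)).trans t.1.1.2.symm⟩ :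
        {w : A × A // 𝒜.proj w.2 = 𝒜.proj w.1}) := by
  refine Continuous.subtype_mk (Continuous.prodMk (by fun_prop) ?_) _
  exact ((continuous_snd.comp continuous_subtype_val).comp (E.continuous_move D)).comp
    (Continuous.subtype_mk (f := fun t : (Prod.map (E.toBasic D) (E.toBasic D) ⁻¹'
        {w : E.BasicSpace D × E.BasicSpace D | E.basicProj D w.2 = E.basicProj D w.1}) =>
      (t.1.1.1.1, t.1.2)) (by fun_prop) fun t => t.2.symm)

/-- A fibrewise binary operation is continuous on `𝒜_Z` if it comes from one on `𝒜`. -/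
theorem continuous_binary
    (op : ∀ x : X, Fibre 𝒜.proj x → Fibre 𝒜.proj x → Fibre 𝒜.proj x)
    (op' : ∀ y : Y, Fibre (E.basicProj D) y → Fibre (E.basicProj D) y → Fibre (E.basicProj D) y)
    (hop : Continuous fun w : {w : A × A // 𝒜.proj w.2 = 𝒜.proj w.1} =>
      (op (𝒜.proj w.1.1) ⟨w.1.1, rfl⟩ ⟨w.1.2, w.2⟩).pt)
    (h : ∀ z a b, E.basicMk D z rfl (op _ a b) =
      op' (E.right.s z) (E.basicMk D z rfl a) (E.basicMk D z rfl b)) :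
    Continuous fun w : {w : E.BasicSpace D × E.BasicSpace D //
        E.basicProj D w.2 = E.basicProj D w.1} =>
      (op' (E.basicProj D w.1.1) ⟨w.1.1, rfl⟩ ⟨w.1.2, w.2⟩).pt := by
  have key : ∀ (a b : A) (x : X) (ha : 𝒜.proj a = x) (hb : 𝒜.proj b = x),
      (op x ⟨a, ha⟩ ⟨b, hb⟩).pt = (op (𝒜.proj a) ⟨a, rfl⟩ ⟨b, hb.trans ha.symm⟩).pt := by
    rintro a b _ rfl hb; rfl
  refine (E.isOpenQuotientMap_toBasic_toBasic D).continuous_comp_iff.1 ?_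
  have h1 := hop.comp (E.continuous_pair D)
  have h2 : Continuous fun t : (Prod.map (E.toBasic D) (E.toBasic D) ⁻¹'
        {w : E.BasicSpace D × E.BasicSpace D | E.basicProj D w.2 = E.basicProj D w.1}) =>
      t.1.1.1.1 := by fun_prop
  refine ((E.continuous_toBasic D).comp (Continuous.subtype_mk (h2.prodMk h1)
    fun t => (op _ _ _).proj_pt.trans t.1.1.2)).congr ?_
  rintro ⟨⟨⟨⟨z, a⟩, ha⟩, ⟨⟨w, b⟩, hb⟩⟩, ht⟩
  have ht' : E.right.s z = E.right.s w := Eq.symm ht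
  have h3 := congrArg Fibre.pt (h z ⟨a, ha⟩ ⟨(D.α (E.trans ht') ⟨b, hb.trans (E.s_trans _).symm⟩).pt,
    (D.α _ _).proj_pt.trans (E.r_trans ht')⟩)
  have h4 : E.basicMk D z rfl ⟨(D.α (E.trans ht') ⟨b, hb.trans (E.s_trans _).symm⟩).pt,
      (D.α _ _).proj_pt.trans (E.r_trans ht')⟩ = ⟨E.toBasic D ⟨(w, b), hb⟩, ht⟩ :=
    Fibre.ext (E.toBasic_eq D ht' b hb).symm
  rw [h4] at h3
  refine Eq.trans ?_ h3
  exact congrArg (E.toBasic D) (Subtype.ext (Prod.ext rfl (key _ _ _ _ _).symm))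

/-- A fibrewise unary operation is continuous on `𝒜_Z` if it comes from one on `𝒜`. -/
theorem continuous_unary
    (op : ∀ x : X, Fibre 𝒜.proj x → Fibre 𝒜.proj x)
    (op' : ∀ y : Y, Fibre (E.basicProj D) y → Fibre (E.basicProj D) y)
    (hop : Continuous fun a : A => (op (𝒜.proj a) ⟨a, rfl⟩).pt)
    (h : ∀ z a, E.basicMk D z rfl (op _ a) = op' (E.right.s z) (E.basicMk D z rfl a)) :
    Continuous fun c : E.BasicSpace D => (op' (E.basicProj D c) ⟨c, rfl⟩).pt := by
  have key : ∀ (a : A) (x : X) (ha : 𝒜.proj a = x),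
      (op x ⟨a, ha⟩).pt = (op (𝒜.proj a) ⟨a, rfl⟩).pt := by
    rintro a _ rfl; rfl
  refine (E.isOpenQuotientMap_toBasic D).continuous_comp_iff.1 ?_
  have h1 : Continuous fun w : D.Pullback E.left => (op (𝒜.proj w.1.2) ⟨w.1.2, rfl⟩).pt :=
    hop.comp (continuous_snd.comp continuous_subtype_val)
  have h2 : Continuous fun w : D.Pullback E.left => w.1.1 := by fun_prop
  refine ((E.continuous_toBasic D).comp (Continuous.subtype_mk (h2.prodMk h1)
    fun w => (op _ _).proj_pt.trans w.2)).congr ?_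
  rintro ⟨⟨z, a⟩, ha⟩
  refine Eq.trans ?_ (congrArg Fibre.pt (h z ⟨a, ha⟩))
  exact congrArg (E.toBasic D) (Subtype.ext (Prod.ext rfl (key _ _ _).symm))

/-- The bundle `𝒜_Z` over `ℋ⁽⁰⁾` obtained from `(𝒜, 𝒢, α)` by the basic construction: its total
space is `𝒢 \ r^* 𝒜`, its projection is `[(z, a)] ↦ s(z)`, and the C*-algebra structure of the
fibres is given by `[(z, a)] + [(z, b)] = [(z, a + b)]`, etc. -/
noncomputable def basicBundle : CStarBundle Y (E.BasicSpace D) where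
  proj := E.basicProj D
  fibreCStar := E.basicFibre D
  continuous_proj := E.continuous_basicProj D
  isOpenMap_proj := (E.isOpenQuotientMap_toBasic D).isOpenMap_iff.2
    (E.isOpenMap_s.comp (E.isOpenMap_pullback_fst D))
  surjective_proj := fun y =>
    ⟨(0 : Fibre (E.basicProj D) y).pt, (0 : Fibre (E.basicProj D) y).proj_pt⟩
  upperSemicontinuous_norm := by
    rw [upperSemicontinuous_iff_isOpen_preimage]
    intro c
    rw [← (E.isOpenQuotientMap_toBasic D).isQuotientMap.isOpen_preimage]
    have h := (upperSemicontinuous_iff_isOpen_preimage.1 𝒜.upperSemicontinuous_norm c).preimage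
      (f := fun w : D.Pullback E.left => w.1.2) (by fun_prop)
    convert h using 1
    ext w
    simp only [mem_preimage, mem_Iio, E.norm_toBasic D]
  continuous_add := E.continuous_binary D (fun _ a b => a + b) (fun _ a b => a + b)
    𝒜.continuous_add fun z a b => E.basicMk_add D z rfl a b
  continuous_mul := E.continuous_binary D (fun _ a b => a * b) (fun _ a b => a * b)
    𝒜.continuous_mul fun z a b => E.basicMk_mul D z rfl a b
  continuous_smul := fun c => E.continuous_unary D (fun _ a => c • a) (fun _ a => c • a)
    (𝒜.continuous_smul c) fun z a => E.basicMk_smul D z rfl c a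
  continuous_star := E.continuous_unary D (fun _ a => star a) (fun _ a => star a)
    𝒜.continuous_star fun z a => E.basicMk_star D z rfl a
  tendsto_zero := fun y => by
    obtain ⟨z, rfl⟩ := E.surjective_s y
    rw [← E.basicMk_zero D z rfl]
    intro W hW
    have h0 : E.toBasic D ⁻¹' W ∈
        𝓝 (⟨(z, (0 : Fibre 𝒜.proj (E.left.r z)).pt), Fibre.proj_pt _⟩ : D.Pullback E.left) :=
      (E.continuous_toBasic D).continuousAt hW
    rw [nhds_subtype_eq_comap, mem_comap] at h0
    obtain ⟨T, hT, hTW⟩ := h0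
    obtain ⟨V, hV, S, hS, hVS⟩ := mem_nhds_prod_iff.1 hT
    have hS' := 𝒜.tendsto_zero (E.left.r z) hS
    obtain ⟨S1, ⟨U, hU, hUS⟩, S2, ⟨N, hN, hNS⟩, rfl⟩ := mem_inf_iff.1 hS'
    refine mem_inf_of_inter (preimage_mem_comap (E.isOpenMap_s.image_mem_nhds
      (inter_mem hV (E.left.continuous_r.continuousAt hU)))) (preimage_mem_comap hN) ?_
    rintro c ⟨⟨w, ⟨hwV, hwU⟩, hwc⟩, hcN⟩
    obtain ⟨b, hb⟩ := (E.basicMk_bijective D w hwc).surjective ⟨c, rfl⟩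
    have hbc : E.toBasic D ⟨(w, b.pt), b.proj_pt⟩ = c := congrArg Fibre.pt hb
    have hnorm := E.norm_toBasic D ⟨(w, b.pt), b.proj_pt⟩
    subst hbc
    refine hTW (hVS ⟨hwV, ?_⟩)
    refine ⟨hUS ?_, hNS ?_⟩
    · change 𝒜.proj b.pt ∈ U
      rw [b.proj_pt]; exact hwU
    · exact mem_preimage.2 (hnorm ▸ hcN)

end GroupoidEquivalence

/-! Both parts follow from one fact: every upper semi-continuous bundle of C*-algebras over a
locally compact Hausdorff space has enough sections (`CStarBundle.hasEnoughSections`). Applied to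
`𝒜_Z` over `ℋ⁽⁰⁾`, this is (b). For (a), a continuous section of `𝒜_Z` through `[(z₀, a)]` lifts to
the map sending `z` to the unique `f z` with `[(z, f z)] = F (s z)`; uniqueness makes it
equivariant, and continuity of the translation arrow `(z, w) ↦ γ`, `γ w = z`, makes it continuous
(`exists_continuous_equivariant`). The lift takes the value `a` at `z₀` exactly.

The general fact is proved by successive approximation. `OscLE f x e` measures the discontinuity of
an arbitrary section at `x`: nearby values are within about `e`, in their own fibres, of points
close to `f x` in the total space. Since the projection is open and every point has neighbourhoods
of small fibrewise diameter, sections with small jumps exist locally through any point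
(`exists_eventually_oscLE`). A partition of unity turns a section with jumps at most `e` on a
compact set into one with jumps at most `e / 2`, at distance at most `2 * e` and with the same value
at a chosen point (`exists_oscLE_half`). Iteration converges uniformly on the compact set,
completeness of the fibres gives a limit without jumps on its interior
(`exists_section_oscLE_zero`), and a cutoff function extends it by zero. -/

namespace CStarBundle

/-! ### Neighbourhoods in the total space of a bundle -/

variable {X A : Type*} [TopologicalSpace X] [TopologicalSpace A] (𝒜 : CStarBundle X A)

theorem norm_mk_eq {x : X} (b : Fibre 𝒜.proj x) :
    ‖(⟨b.pt, rfl⟩ : Fibre 𝒜.proj (𝒜.proj b.pt))‖ = ‖b‖ := by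
  obtain ⟨b, rfl⟩ := b; rfl

theorem eventually_norm_lt {x : X} {b : Fibre 𝒜.proj x} {c : ℝ} (h : ‖b‖ < c) :
    ∀ᶠ a in 𝓝 b.pt, ‖(⟨a, rfl⟩ : Fibre 𝒜.proj (𝒜.proj a))‖ < c :=
  𝒜.upperSemicontinuous_norm b.pt c ((𝒜.norm_mk_eq b).trans_lt h)

/-- Continuity of addition, freed from the subtype of pairs over a common point, so that it applies
to elements of any fibre type. -/
theorem exists_nhds_add {x : X} (b c : Fibre 𝒜.proj x) {W : Set A} (hW : W ∈ 𝓝 (b + c).pt) :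
    ∃ U ∈ 𝓝 b.pt, ∃ V ∈ 𝓝 c.pt, ∀ (y : X) (u v : Fibre 𝒜.proj y),
      u.pt ∈ U → v.pt ∈ V → (u + v).pt ∈ W := by
  obtain ⟨b, rfl⟩ := b
  obtain ⟨c, hc⟩ := c
  have h := 𝒜.continuous_add.continuousAt (x := ⟨(b, c), hc⟩) hW
  rw [mem_map, nhds_subtype_eq_comap, mem_comap] at h
  obtain ⟨T, hT, hTW⟩ := h
  obtain ⟨U, hU, V, hV, hUV⟩ := mem_nhds_prod_iff.1 hT
  refine ⟨U, hU, V, hV, ?_⟩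
  rintro _ ⟨u, rfl⟩ ⟨v, hv⟩ hu hv'
  exact hTW (a := ⟨(u, v), hv⟩) (hUV ⟨hu, hv'⟩)

theorem exists_nhds_smul {x : X} (k : ℂ) (b : Fibre 𝒜.proj x) {W : Set A}
    (hW : W ∈ 𝓝 (k • b).pt) :
    ∃ U ∈ 𝓝 b.pt, ∀ (y : X) (u : Fibre 𝒜.proj y), u.pt ∈ U → (k • u).pt ∈ W := by
  obtain ⟨b, rfl⟩ := b
  refine ⟨_, (𝒜.continuous_smul k).continuousAt hW, ?_⟩
  rintro _ ⟨u, rfl⟩ hu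
  exact hu

/-- The axiom `tendsto_zero` with its filters unfolded: tubes of small norm form arbitrarily small
neighbourhoods of a zero. -/
theorem exists_nhds_zero (x : X) {W : Set A} (hW : W ∈ 𝓝 (0 : Fibre 𝒜.proj x).pt) :
    ∃ U ∈ 𝓝 x, ∃ δ > 0, ∀ y ∈ U, ∀ u : Fibre 𝒜.proj y, ‖u‖ < δ → u.pt ∈ W := by
  obtain ⟨S1, ⟨U, hU, hUS⟩, S2, ⟨N, hN, hNS⟩, rfl⟩ := mem_inf_iff.1 (𝒜.tendsto_zero x hW)
  obtain ⟨δ, hδ, hN⟩ := Metric.mem_nhds_iff.1 hN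
  refine ⟨U, hU, δ, hδ, ?_⟩
  rintro _ hy ⟨u, rfl⟩ hu
  exact ⟨hUS hy, hNS (hN (by simpa using hu))⟩

/-- A point which is close in norm to a point of its fibre near `b` is itself near `b`. -/
theorem exists_nhds_norm {x : X} (b : Fibre 𝒜.proj x) {W : Set A} (hW : W ∈ 𝓝 b.pt) :
    ∃ U ∈ 𝓝 b.pt, ∃ δ > 0, ∀ (y : X) (u v : Fibre 𝒜.proj y),
      u.pt ∈ U → ‖v - u‖ < δ → v.pt ∈ W := by
  -- Write `v = u + (v - u)`, where the second summand lies in a small tube around zero.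
  obtain ⟨U, hU, V, hV, h⟩ := 𝒜.exists_nhds_add b 0 (W := W) (by rwa [add_zero])
  obtain ⟨V', hV', δ, hδ, h'⟩ := 𝒜.exists_nhds_zero x hV
  have hV'' : 𝒜.proj ⁻¹' V' ∈ 𝓝 b.pt :=
    𝒜.continuous_proj.continuousAt (by rwa [b.proj_pt])
  refine ⟨U ∩ 𝒜.proj ⁻¹' V', inter_mem hU hV'', δ, hδ, fun y u v hu huv => ?_⟩
  have hy : y ∈ V' := by simpa [u.proj_pt] using hu.2
  simpa using h y u (v - u) hu.1 (h' y hy _ huv)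

/-- Every point of the total space has an open neighbourhood which meets every fibre in a set of
small diameter. -/
theorem exists_isOpen_norm_sub_lt {x : X} (b : Fibre 𝒜.proj x) {ε : ℝ} (hε : 0 < ε) :
    ∃ V, IsOpen V ∧ b.pt ∈ V ∧ ∀ (y : X) (u v : Fibre 𝒜.proj y),
      u.pt ∈ V → v.pt ∈ V → ‖u - v‖ < ε := by
  -- The difference map is continuous and sends `(b, b)` to zero, so upper semicontinuity of the
  -- norm bounds differences of points near `b`.
  have h0 := 𝒜.eventually_norm_lt (b := b + (-1 : ℂ) • b) (c := ε) (by simpa using hε)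
  obtain ⟨U, hU, V, hV, h⟩ := 𝒜.exists_nhds_add _ _ h0
  obtain ⟨V', hV', h'⟩ := 𝒜.exists_nhds_smul _ _ hV
  obtain ⟨T, hT, hTo, hbT⟩ := mem_nhds_iff.1 (inter_mem hU hV')
  refine ⟨T, hTo, hbT, fun y u v hu hv => ?_⟩
  have := h y u _ (hT hu).1 (h' y v (hT hv).2)
  rw [mem_ofPred_eq, 𝒜.norm_mk_eq] at this
  simpa [sub_eq_add_neg] using this

/-! ### Calculus of sections with bounded jumps -/

variable {𝒜}

/-- The section `f`, not necessarily continuous, jumps at most by `e` at the point `x`. -/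
def OscLE (f : ∀ x, Fibre 𝒜.proj x) (x : X) (e : ℝ) : Prop :=
  ∀ δ > 0, ∀ W ∈ 𝓝 (f x).pt, ∀ᶠ y in 𝓝 x, ∃ w : Fibre 𝒜.proj y, w.pt ∈ W ∧ ‖f y - w‖ < e + δ

theorem OscLE.mono {f : ∀ x, Fibre 𝒜.proj x} {x : X} {e e' : ℝ} (h : OscLE f x e) (he : e ≤ e') :
    OscLE f x e' := fun δ hδ W hW =>
  (h δ hδ W hW).mono fun _ ⟨w, hw, hw'⟩ => ⟨w, hw, hw'.trans_le (by linarith)⟩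

theorem OscLE.of_forall_pos {f : ∀ x, Fibre 𝒜.proj x} {x : X} {e : ℝ}
    (h : ∀ δ > 0, OscLE f x (e + δ)) : OscLE f x e := fun δ hδ W hW =>
  (h (δ / 2) (half_pos hδ) (δ / 2) (half_pos hδ) W hW).mono fun _ ⟨w, hw, hw'⟩ =>
    ⟨w, hw, hw'.trans_le (by linarith)⟩

theorem OscLE.congr {f g : ∀ x, Fibre 𝒜.proj x} {x : X} {e : ℝ} (h : OscLE f x e)
    (hfg : ∀ᶠ y in 𝓝 x, f y = g y) : OscLE g x e := fun δ hδ W hW => by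
  filter_upwards [h δ hδ W (hfg.self_of_nhds ▸ hW), hfg] with y ⟨w, hw, hw'⟩ hy
  exact ⟨w, hw, hy ▸ hw'⟩

theorem OscLE.add {f g : ∀ x, Fibre 𝒜.proj x} {x : X} {e e' : ℝ} (hf : OscLE f x e)
    (hg : OscLE g x e') : OscLE (f + g) x (e + e') := fun δ hδ W hW => by
  obtain ⟨U, hU, V, hV, h⟩ := 𝒜.exists_nhds_add _ _ hW
  filter_upwards [hf _ (half_pos hδ) U hU, hg _ (half_pos hδ) V hV]
    with y ⟨u, hu, hu'⟩ ⟨v, hv, hv'⟩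
  refine ⟨u + v, h y u v hu hv, ?_⟩
  rw [Pi.add_apply, add_sub_add_comm]
  exact (norm_add_le _ _).trans_lt (by linarith)

/-- The value at `y` is within about `e` of a point near `f x`, and by upper semicontinuity the norm
of that point hardly exceeds `‖f x‖`. -/
theorem OscLE.eventually_norm_lt {f : ∀ x, Fibre 𝒜.proj x} {x : X} {e c : ℝ} (h : OscLE f x e)
    (hc : ‖f x‖ + e < c) : ∀ᶠ y in 𝓝 x, ‖f y‖ < c := by
  obtain ⟨δ, hδ, hc⟩ : ∃ δ > 0, ‖f x‖ + e + 2 * δ = c :=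
    ⟨(c - (‖f x‖ + e)) / 2, by linarith, by ring⟩
  filter_upwards [h δ hδ _ (𝒜.eventually_norm_lt (b := f x) (c := ‖f x‖ + δ) (by linarith))]
    with y ⟨w, hw, hw'⟩
  replace hw := (𝒜.norm_mk_eq w).symm.trans_lt hw
  have := norm_add_le (f y - w) w
  rw [sub_add_cancel] at this
  linarith

theorem oscLE_zero (x : X) : OscLE (0 : ∀ x, Fibre 𝒜.proj x) x 0 := fun δ hδ W hW => by
  obtain ⟨U, hU, ε, hε, h⟩ := 𝒜.exists_nhds_zero x hW
  filter_upwards [hU] with y hy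
  exact ⟨0, h y hy 0 (by simpa using hε), by simpa using hδ⟩

/-- Comparing `k y • f y` with `k x • u` needs only continuity of multiplication by the fixed scalar
`k x`; the error `(k y - k x) • f y` is small because `f` is bounded near `x`. -/
theorem OscLE.smul {f : ∀ x, Fibre 𝒜.proj x} {x : X} {e : ℝ} (hf : OscLE f x e) {k : X → ℂ}
    (hk : ContinuousAt k x) : OscLE (fun y => k y • f y) x (‖k x‖ * e) := fun δ hδ W hW => by
  obtain ⟨U, hU, h⟩ := 𝒜.exists_nhds_smul _ _ hW
  obtain ⟨C, hC, hfC⟩ : ∃ C > 0, ‖f x‖ + e < C :=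
    ⟨max (‖f x‖ + e) 0 + 1, by positivity, by linarith [le_max_left (‖f x‖ + e) 0]⟩
  have hk' : ∀ᶠ y in 𝓝 x, ‖k y - k x‖ < δ / 2 / C := by
    simpa [dist_eq_norm] using Metric.tendsto_nhds.1 hk (δ / 2 / C) (by positivity)
  have hK : 0 < ‖k x‖ + 1 := by positivity
  filter_upwards [hf (δ / 2 / (‖k x‖ + 1)) (by positivity) U hU, hf.eventually_norm_lt hfC, hk']
    with y ⟨u, hu, hu'⟩ hfy hky
  refine ⟨k x • u, h y u hu, ?_⟩
  have e1 : k y • f y - k x • u = k x • (f y - u) + (k y - k x) • f y := by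
    rw [smul_sub, sub_smul]; abel
  have h1 : ‖k x • (f y - u)‖ ≤ ‖k x‖ * e + δ / 2 := by
    rw [norm_smul]
    refine (mul_le_mul_of_nonneg_left hu'.le (norm_nonneg _)).trans ?_
    rw [mul_add]
    have : ‖k x‖ * (δ / 2 / (‖k x‖ + 1)) ≤ (‖k x‖ + 1) * (δ / 2 / (‖k x‖ + 1)) := by
      gcongr; linarith
    rw [mul_div_cancel₀ _ hK.ne'] at this
    linarith
  have h2 : ‖(k y - k x) • f y‖ < δ / 2 := by
    rw [norm_smul]
    calc ‖k y - k x‖ * ‖f y‖ ≤ ‖k y - k x‖ * C := by gcongr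
      _ < δ / 2 / C * C := by gcongr
      _ = δ / 2 := div_mul_cancel₀ _ hC.ne'
  rw [e1]
  exact (norm_add_le _ _).trans_lt (by linarith)

theorem oscLE_sum {ι : Type*} (t : Finset ι) {f : ι → ∀ x, Fibre 𝒜.proj x} {x : X} {e : ι → ℝ}
    (h : ∀ i ∈ t, OscLE (f i) x (e i)) : OscLE (∑ i ∈ t, f i) x (∑ i ∈ t, e i) := by
  classical
  induction t using Finset.induction_on with
  | empty => simpa using oscLE_zero x
  | insert i t hi ih =>
    rw [Finset.sum_insert hi, Finset.sum_insert hi]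
    exact (h i (Finset.mem_insert_self _ _)).add
      (ih fun j hj => h j (Finset.mem_insert_of_mem hj))

/-- With no jump, `f y` is arbitrarily close in norm to points near `f x`, hence is itself near `f
x` by `exists_nhds_norm`. -/
theorem OscLE.continuousAt {f : ∀ x, Fibre 𝒜.proj x} {x : X} (h : OscLE f x 0) :
    ContinuousAt (fun y => (f y).pt) x := by
  intro W hW
  obtain ⟨U, hU, δ, hδ, hUW⟩ := 𝒜.exists_nhds_norm _ hW
  refine mem_map.2 ?_
  filter_upwards [h δ hδ U hU] with y ⟨u, hu, hu'⟩
  exact hUW y u (f y) hu (by linarith)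

/-! ### Construction of continuous sections by successive approximation -/

/-- Through every point there is a section which jumps little in a neighbourhood. -/
theorem exists_eventually_oscLE {x : X} (b : Fibre 𝒜.proj x) {ε : ℝ} (hε : 0 < ε) :
    ∃ f : ∀ x, Fibre 𝒜.proj x, f x = b ∧ ∀ᶠ y in 𝓝 x, OscLE f y ε := by
  classical
  obtain ⟨V, hVo, hbV, hV⟩ := 𝒜.exists_isOpen_norm_sub_lt b hε
  -- Pick values in `V` wherever the fibre meets `V`; the second clause pins the value over `x` to
  -- be `b`, transported along the equality of base points.
  have key : ∀ y, ∃ c : Fibre 𝒜.proj y, (y ∈ 𝒜.proj '' V → c.pt ∈ V) ∧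
      ∀ h : x = y, c = h ▸ b := by
    intro y
    by_cases hxy : x = y
    · subst hxy
      exact ⟨b, fun _ => hbV, fun _ => rfl⟩
    · by_cases hy : y ∈ 𝒜.proj '' V
      · obtain ⟨c, hc, hcy⟩ := hy
        exact ⟨⟨c, hcy⟩, fun _ => hc, fun h => absurd h hxy⟩
      · exact ⟨0, fun h => absurd h hy, fun h => absurd h hxy⟩
  choose f hfV hfb using key
  refine ⟨f, hfb x rfl, ?_⟩
  have hU : 𝒜.proj '' V ∈ 𝓝 x :=
    (𝒜.isOpenMap_proj V hVo).mem_nhds ⟨b.pt, hbV, b.proj_pt⟩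
  filter_upwards [hU, eventually_mem_nhds_iff.2 hU] with y hy hyU δ hδ W hW
  -- Openness of the projection gives a point of `V ∩ W` over each `z` near `y`; since `f z` is also
  -- in `V`, the two differ by less than `ε`.
  have h1 : 𝒜.proj '' (V ∩ W) ∈ 𝓝 y := by
    have := 𝒜.isOpenMap_proj.image_mem_nhds (inter_mem (hVo.mem_nhds (hfV y hy)) hW)
    rwa [(f y).proj_pt] at this
  filter_upwards [h1, hyU] with z ⟨w, hw, hwz⟩ hz
  exact ⟨⟨w, hwz⟩, hw.2, (hV z _ _ (hfV z hz) hw.1).trans (by linarith)⟩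

/-- Correct `f` by a section `k` through `g x - f x` with tiny jumps. Then `f + k` agrees with `g`
at `x` and jumps by little more than `e`. Near `x` both `g - f` and `k` have norm at most about `c`,
so `g` differs from `f + k` by about `2 * c`. -/
theorem OscLE.of_norm_sub_le {f g : ∀ x, Fibre 𝒜.proj x} {x : X} {e c : ℝ} (hf : OscLE f x e)
    (h : ∀ᶠ y in 𝓝 x, ‖g y - f y‖ ≤ c) : OscLE g x (e + 2 * c) := by
  refine .of_forall_pos fun δ hδ => ?_
  obtain ⟨k, hk, hk'⟩ := exists_eventually_oscLE (g x - f x) (ε := δ / 4) (by positivity)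
  have hk0 := hk'.self_of_nhds
  have hx := h.self_of_nhds
  have hfk := hf.add hk0
  have hkn := hk0.eventually_norm_lt (c := c + δ / 2) (by rw [hk]; linarith)
  intro η hη W hW
  filter_upwards [hfk η hη W (by simpa [hk] using hW), hkn, h] with y ⟨w, hw, hw'⟩ hky hy
  refine ⟨w, hw, ?_⟩
  have e1 : g y - w = (g y - f y) - k y + ((f + k) y - w) := by
    rw [Pi.add_apply]; abel
  rw [e1]
  have := norm_add_le ((g y - f y) - k y) ((f + k) y - w)
  have := norm_sub_le (g y - f y) (k y)
  linarith

/-- Improvement of a section which jumps at most by `e` on a compact set to one which jumps at most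
by `e / 2`, with a prescribed value left unchanged. -/
theorem exists_oscLE_half [T2Space X] [LocallyCompactSpace X] {K : Set X} (hK : IsCompact K)
    {x₀ : X} (hx₀ : x₀ ∈ K) {e : ℝ} (he : 0 < e) {g : ∀ x, Fibre 𝒜.proj x}
    (hg : ∀ x ∈ K, OscLE g x e) :
    ∃ g' : ∀ x, Fibre 𝒜.proj x, g' x₀ = g x₀ ∧ (∀ x ∈ K, OscLE g' x (e / 2)) ∧
      ∀ x ∈ K, ‖g' x - g x‖ ≤ 2 * e := by
  have key : ∀ x ∈ K, ∃ (f : ∀ x, Fibre 𝒜.proj x) (U : Set X), IsOpen U ∧ x ∈ U ∧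
      (∀ y ∈ U, OscLE f y (e / 2)) ∧ (∀ y ∈ U, ‖f y - g y‖ < 2 * e) ∧
      (x₀ ∈ U → f x₀ = g x₀) := by
    intro x hx
    obtain ⟨f, hfx, hf⟩ := exists_eventually_oscLE (g x) (half_pos he)
    -- The section `f - g` vanishes at `x` and jumps there by at most `3 * e / 2`, so its norm stays
    -- below `2 * e` nearby.
    have h1 : OscLE (f + fun y => (-1 : ℂ) • g y) x (e / 2 + ‖(-1 : ℂ)‖ * e) :=
      hf.self_of_nhds.add ((hg x hx).smul continuousAt_const)
    have h2 : ∀ᶠ y in 𝓝 x, ‖f y - g y‖ < 2 * e := by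
      have := h1.eventually_norm_lt (c := 2 * e) (by simp [hfx]; linarith)
      simpa [sub_eq_add_neg] using this
    -- Neighbourhoods of points other than `x₀` are shrunk to miss `x₀`, so only local sections with
    -- the right value contribute there.
    have h3 : ∀ᶠ y in 𝓝 x, y = x₀ → f x₀ = g x₀ := by
      by_cases hxx : x = x₀
      · subst hxx; exact .of_forall fun _ _ => hfx
      · filter_upwards [isOpen_compl_singleton.mem_nhds (show x ∈ ({x₀}ᶜ : Set X) from hxx)]
          with y hy hy' using absurd hy' hy
    obtain ⟨U, hU, hUo, hxU⟩ := mem_nhds_iff.1 (hf.and (h2.and h3))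
    exact ⟨f, U, hUo, hxU, fun y hy => (hU hy).1, fun y hy => (hU hy).2.1,
      fun h => (hU h).2.2 rfl⟩
  choose! f U hUo hxU hfo hfn hfx using key
  obtain ⟨t, htK, hKt⟩ := hK.elim_nhds_subcover U fun x hx => (hUo x hx).mem_nhds (hxU x hx)
  let v : Fin t.card → X := fun i => (t.equivFin.symm i : X)
  have hvK : ∀ i, v i ∈ K := fun i => htK _ (t.equivFin.symm i).2
  obtain ⟨φ, hφs, hφ1, hφI, -⟩ := exists_continuous_sum_one_of_isOpen_isCompact
    (s := fun i => U (v i)) (fun i => hUo _ (hvK i)) hK (by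
      intro y hy
      obtain ⟨x, hxt, hyx⟩ := mem_iUnion₂.1 (hKt hy)
      exact mem_iUnion.2 ⟨t.equivFin ⟨x, hxt⟩, by simpa [v] using hyx⟩)
  have hsum : ∀ y ∈ K, ∑ i, φ i y = 1 := fun y hy => by simpa using hφ1 hy
  have hsub : ∀ y ∈ K, (∑ i, fun y => (φ i y : ℂ) • f (v i) y) y - g y =
      ∑ i, (φ i y : ℂ) • (f (v i) y - g y) := fun y hy => by
    simp only [smul_sub, Finset.sum_sub_distrib, ← Finset.sum_smul, Finset.sum_apply]
    rw [← Complex.ofReal_sum, hsum y hy, Complex.ofReal_one, one_smul]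
  have hU : ∀ i y, φ i y ≠ 0 → y ∈ U (v i) := fun i y h =>
    hφs i (subset_tsupport _ h)
  refine ⟨∑ i, fun y => (φ i y : ℂ) • f (v i) y, ?_, fun y hy => ?_, fun y hy => ?_⟩
  · rw [← sub_eq_zero, hsub _ hx₀]
    refine Finset.sum_eq_zero fun i _ => ?_
    by_cases h : φ i x₀ = 0
    · simp [h]
    · rw [hfx _ (hvK i) (hU i _ h), sub_self, smul_zero]
  · have h := oscLE_sum Finset.univ (f := fun i y => (φ i y : ℂ) • f (v i) y) (x := y)
      (e := fun i => φ i y * (e / 2)) fun i _ => by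
        -- The local section is controlled only on its own open set; off the closed support of `φ i`
        -- the term vanishes near `y`, and the claimed bound is zero.
        by_cases h : y ∈ tsupport (φ i)
        · have h1 := (hfo _ (hvK i) y (hφs i h)).smul (k := fun y => (φ i y : ℂ))
            (by fun_prop)
          refine h1.mono (le_of_eq ?_)
          simp [abs_of_nonneg (hφI i y).1]
        · have h0 := notMem_tsupport_iff_eventuallyEq.1 h
          rw [h0.self_of_nhds]
          refine ((oscLE_zero y).mono (by simp)).congr ?_
          filter_upwards [h0] with z hz
          simp [hz]
    rw [← Finset.sum_mul, hsum y hy, one_mul] at h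
    exact h
  · rw [hsub y hy]
    refine (norm_sum_le _ _).trans ?_
    calc ∑ i, ‖(φ i y : ℂ) • (f (v i) y - g y)‖ ≤ ∑ i, φ i y * (2 * e) := by
          refine Finset.sum_le_sum fun i _ => ?_
          rw [norm_smul, Complex.norm_real, Real.norm_of_nonneg (hφI i y).1]
          by_cases h : φ i y = 0
          · simp [h]
          · exact mul_le_mul_of_nonneg_left (hfn _ (hvK i) y (hU i y h)).le (hφI i y).1
      _ = 2 * e := by rw [← Finset.sum_mul, hsum y hy, one_mul]

/-- Near every point there is a continuous section with a prescribed value at the point. -/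
theorem exists_section_oscLE_zero [T2Space X] [LocallyCompactSpace X] {x₀ : X}
    (a : Fibre 𝒜.proj x₀) :
    ∃ (g : ∀ x, Fibre 𝒜.proj x) (K : Set X), IsCompact K ∧ x₀ ∈ interior K ∧ g x₀ = a ∧
      ∀ x ∈ interior K, OscLE g x 0 := by
  obtain ⟨g₀, hg₀, hg₀'⟩ := exists_eventually_oscLE a one_pos
  obtain ⟨K, hKx, hKs, hK⟩ := local_compact_nhds hg₀'
  have hx₀ : x₀ ∈ K := mem_of_mem_nhds hKx
  -- The improvement becomes a total function of the bound and the section, so that it can be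
  -- iterated by recursion.
  choose! F hFx hFo hFn using fun (e : ℝ) (g : ∀ x, Fibre 𝒜.proj x) (h : 0 < e ∧
    ∀ x ∈ K, OscLE g x e) => exists_oscLE_half hK hx₀ h.1 h.2
  let G : ℕ → ∀ x, Fibre 𝒜.proj x := fun n => Nat.rec g₀ (fun n g => F (1 / 2 ^ n) g) n
  have hG : ∀ n, ∀ x ∈ K, OscLE (G n) x (1 / 2 ^ n) := by
    intro n
    induction n with
    | zero => exact fun x hx => (hKs hx : OscLE g₀ x 1).mono (by norm_num)
    | succ n ih =>
      have := hFo _ _ ⟨by positivity, ih⟩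
      intro x hx
      refine (this x hx).mono (le_of_eq ?_)
      rw [pow_succ, div_div]
  have hGx : ∀ n, G n x₀ = a := by
    intro n
    induction n with
    | zero => exact hg₀
    | succ n ih => exact (hFx _ _ ⟨by positivity, hG n⟩).trans ih
  -- The distance `2 * (1 / 2 ^ n)` is written as `C / 2 / 2 ^ n` with `C = 4`, the shape of the
  -- geometric series lemmas; the limit is then within `4 / 2 ^ n` of `G n`.
  have hGn : ∀ n, ∀ x ∈ K, dist (G n x) (G (n + 1) x) ≤ 4 / 2 / 2 ^ n := fun n x hx => by
    rw [dist_comm, dist_eq_norm]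
    refine (hFn _ _ ⟨by positivity, hG n⟩ x hx).trans (le_of_eq (by ring))
  have hlim : ∀ x, ∃ c, x ∈ K → Tendsto (fun n => G n x) atTop (𝓝 c) := fun x => by
    by_cases hx : x ∈ K
    · obtain ⟨c, hc⟩ := cauchySeq_tendsto_of_complete
        (cauchySeq_of_le_geometric_two fun n => hGn n x hx)
      exact ⟨c, fun _ => hc⟩
    · exact ⟨0, fun h => absurd h hx⟩
  choose g hg using hlim
  refine ⟨g, K, hK, mem_interior_iff_mem_nhds.2 hKx, ?_, fun x hx => ?_⟩
  · refine tendsto_nhds_unique (hg x₀ hx₀) ?_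
    simp only [hGx]
    exact tendsto_const_nhds
  -- Here `9 = 1 + 2 * 4`: the jump of `G n` plus twice its distance to the limit. The distance
  -- bound is needed on a neighbourhood of `x`, hence the restriction to the interior.
  · have hn : ∀ n : ℕ, OscLE g x (9 * (1 / 2) ^ n) := fun n => by
      refine ((hG n x (interior_subset hx)).of_norm_sub_le (g := g) (c := 4 / 2 ^ n) ?_).mono
        (le_of_eq ?_)
      · filter_upwards [mem_interior_iff_mem_nhds.1 hx] with y hy
        rw [← dist_eq_norm, dist_comm]
        exact dist_le_of_le_geometric_two_of_tendsto (fun n => hGn n y hy) (hg y hy) n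
      · rw [one_div_pow]; ring
    refine .of_forall_pos fun δ hδ => ?_
    obtain ⟨n, hn'⟩ := exists_pow_lt_of_lt_one (show 0 < δ / 9 by positivity)
      (show (1 / 2 : ℝ) < 1 by norm_num)
    exact (hn n).mono (by linarith)

/-- A bundle of C*-algebras over a locally compact Hausdorff space has enough sections. -/
theorem hasEnoughSections [T2Space X] [LocallyCompactSpace X] : 𝒜.HasEnoughSections := by
  intro x₀ a
  obtain ⟨g, K, hK, hx₀, hga, hg⟩ := exists_section_oscLE_zero a
  obtain ⟨L, hL, hxL, hLK⟩ := exists_compact_subset isOpen_interior hx₀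
  obtain ⟨χ, hχ1, hχ0, -, -⟩ := exists_continuous_one_zero_of_isCompact
    (isCompact_singleton (x := x₀)) (isOpen_interior (s := L)).isClosed_compl
    (disjoint_singleton_left.2 (not_not.2 hxL))
  have hχ : Function.support χ ⊆ L := fun y hy =>
    interior_subset (by_contra fun h => hy (hχ0 h))
  refine ⟨fun y => ((χ y : ℂ) • g y).pt, fun y => Fibre.proj_pt _, ?_, ?_, ?_⟩
  · refine continuous_iff_continuousAt.2 fun y => OscLE.continuousAt
      (f := fun y => (χ y : ℂ) • g y) ?_
    -- Since `L ⊆ interior K`, the open sets `interior K` and `Lᶜ` cover the base: `g` has no jumps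
    -- on the first, and the cut-off section vanishes on the second.
    by_cases hy : y ∈ interior K
    · simpa using (hg y hy).smul (k := fun y => (χ y : ℂ)) (by fun_prop)
    · refine (oscLE_zero y).congr ?_
      filter_upwards [hL.isClosed.isOpen_compl.mem_nhds (fun h => hy (hLK h))] with z hz
      have : χ z = 0 := by_contra fun h => hz (hχ h)
      simp [this]
  · refine hL.of_isClosed_subset isClosed_closure (closure_minimal ?_ hL.isClosed)
    exact fun y hy => hχ fun h => hy (by simp [h])
  · change (χ x₀ : ℂ) • g x₀ = a
    rw [hχ1 rfl, hga]; simp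

end CStarBundle

/-! ### Topology of the unit space -/

namespace TopologicalGroupoid

variable {G X : Type*} [TopologicalSpace G] [TopologicalSpace X] [T2Space G]
  (Γ : TopologicalGroupoid G X)

/-- The source map is a continuous left inverse and the arrow space is Hausdorff. This passes
separation and local compactness from the arrows to the units. -/
theorem isClosedEmbedding_unit : IsClosedEmbedding Γ.unit :=
  Function.LeftInverse.isClosedEmbedding Γ.s_unit Γ.continuous_s Γ.continuous_unit

end TopologicalGroupoid

/-! ### Lifting sections of `𝒜_Z` to equivariant maps -/

namespace GroupoidEquivalence

variable {G X H Y Z A : Type*} [TopologicalSpace G] [TopologicalSpace X]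
  [TopologicalSpace H] [TopologicalSpace Y] [TopologicalSpace Z] [TopologicalSpace A]
  {Γ : TopologicalGroupoid G X} {Δ : TopologicalGroupoid H Y} (E : GroupoidEquivalence Γ Δ Z)
  {𝒜 : CStarBundle X A} (D : GroupoidDynamicalSystem Γ 𝒜)

theorem toBasic_act (γ : G) (z : Z) (h : Γ.s γ = E.left.r z) (a : A)
    (ha : 𝒜.proj a = E.left.r z) :
    E.toBasic D ⟨(E.left.act γ z h, (D.α γ ⟨a, ha.trans h.symm⟩).pt),
      (D.α γ _).proj_pt.trans (E.left.r_act γ z h).symm⟩ = E.toBasic D ⟨(z, a), ha⟩ :=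
  (Quotient.sound ⟨γ, h, rfl⟩ : E.toBasic D ⟨(z, a), ha⟩ = _).symm

/-- By freeness, an arrow relating two points over the same `z` is a unit, and units act trivially
on the fibres. -/
theorem toBasic_injective {z : Z} {a b : A} (ha : 𝒜.proj a = E.left.r z)
    (hb : 𝒜.proj b = E.left.r z)
    (h : E.toBasic D ⟨(z, a), ha⟩ = E.toBasic D ⟨(z, b), hb⟩) : a = b :=
  congrArg Fibre.pt ((E.basicMk_bijective D z rfl).injective (a₁ := ⟨a, ha⟩) (a₂ := ⟨b, hb⟩)
    (Fibre.ext h))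

/-- A map `f : Z → 𝒜` over the anchor map is continuous if `z ↦ [(z, f z)]` is. -/
theorem continuous_of_continuous_toBasic {f : Z → A} (hf : ∀ z, 𝒜.proj (f z) = E.left.r z)
    (h : Continuous fun z => E.toBasic D ⟨(z, f z), hf z⟩) : Continuous f := by
  -- The fibre product of `Z` with the total space of `𝒜_Z` is an open quotient of the fibre product
  -- of `Z` with `r^* 𝒜`, so continuity can be tested upstairs.
  have hq : IsOpenQuotientMap ({w : Z × E.BasicSpace D |
      E.right.s w.1 = E.basicProj D w.2}.restrictPreimage (Prod.map id (E.toBasic D))) := by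
    have h := IsOpenQuotientMap.id.prodMap (X := Z) (E.isOpenQuotientMap_toBasic D)
    exact ⟨h.surjective.restrictPreimage _, h.continuous.restrictPreimage,
      h.isOpenMap.restrictPreimage _⟩
  choose k hk using fun t : {w : Z × E.BasicSpace D | E.right.s w.1 = E.basicProj D w.2} =>
    (E.basicMk_bijective D t.1.1 rfl).surjective ⟨t.1.2, t.2.symm⟩
  have hk' : ∀ t, E.toBasic D ⟨(t.1.1, (k t).pt), (k t).proj_pt⟩ = t.1.2 :=
    fun t => congrArg Fibre.pt (hk t)
  -- Here `k (z, c)` is the unique `a` with `[(z, a)] = c`. On a representative `(w, b)` of `c` it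
  -- is `α_γ(b)` with `γ w = z`, which is continuous by `continuous_move`.
  have hkc : Continuous fun t => (k t).pt := by
    refine hq.continuous_comp_iff.1 (((continuous_snd.comp continuous_subtype_val).comp
      (E.continuous_move D)).congr fun t => ?_)
    refine (E.toBasic_injective D (k _).proj_pt
      ((D.α _ _).proj_pt.trans (E.r_trans t.2)) ((hk' _).trans ?_)).symm
    exact E.toBasic_eq D t.2 _ _
  refine (hkc.comp (Continuous.subtype_mk (continuous_id.prodMk h) fun z => rfl)).congr
    fun z => ?_
  exact E.toBasic_injective D (k _).proj_pt (hf z) (hk' ⟨(z, E.toBasic D ⟨(z, f z), hf z⟩), rfl⟩)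

/-- A continuous section of `𝒜_Z` lifts to a continuous equivariant map `Z → 𝒜`. -/
theorem exists_continuous_equivariant {F : Y → E.BasicSpace D} (hF : Continuous F)
    (hFp : ∀ y, E.basicProj D (F y) = y) :
    ∃ (f : Z → A) (hf : ∀ z, 𝒜.proj (f z) = E.left.r z), Continuous f ∧
      (∀ (γ : G) (z : Z) (h : Γ.s γ = E.left.r z),
        f (E.left.act γ z h) = (D.α γ ⟨f z, (hf z).trans h.symm⟩).pt) ∧
      ∀ z, E.toBasic D ⟨(z, f z), hf z⟩ = F (E.right.s z) := by
  choose k hk using fun z => (E.basicMk_bijective D z rfl).surjective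
    ⟨F (E.right.s z), hFp _⟩
  have hk' : ∀ z, E.toBasic D ⟨(z, (k z).pt), (k z).proj_pt⟩ = F (E.right.s z) :=
    fun z => congrArg Fibre.pt (hk z)
  refine ⟨fun z => (k z).pt, fun z => (k z).proj_pt, ?_, fun γ z h => ?_, hk'⟩
  · refine E.continuous_of_continuous_toBasic D (fun z => (k z).proj_pt) ?_
    simp only [hk']
    exact hF.comp E.right.continuous_s
  -- Both sides lie over `γ z` and represent the class `F (s z)`, because `s (γ z) = s z`.
  · refine E.toBasic_injective D (k _).proj_pt
      ((D.α γ _).proj_pt.trans (E.left.r_act γ z h).symm) ?_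
    rw [hk', E.toBasic_act D γ z h _ (k z).proj_pt, hk', E.s_act_left]

end GroupoidEquivalence

theorem mainTheorem9 {G X H Y Z A : Type*}
    [TopologicalSpace G] [LocallyCompactSpace G] [T2Space G] [SecondCountableTopology G]
    [MeasurableSpace G] [BorelSpace G] [TopologicalSpace X]
    [TopologicalSpace H] [LocallyCompactSpace H] [T2Space H] [SecondCountableTopology H]
    [MeasurableSpace H] [BorelSpace H] [TopologicalSpace Y]
    [TopologicalSpace Z] [LocallyCompactSpace Z] [T2Space Z]
    [TopologicalSpace A]
    (Γ : TopologicalGroupoid G X) (_haarΓ : HaarSystem Γ)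
    (Δ : TopologicalGroupoid H Y) (_haarΔ : HaarSystem Δ)
    (E : GroupoidEquivalence Γ Δ Z)
    (𝒜 : CStarBundle X A) (h𝒜 : 𝒜.HasEnoughSections)
    (D : GroupoidDynamicalSystem Γ 𝒜) :
    (∀ (z₀ : Z) (a : Fibre 𝒜.proj (E.left.r z₀)) (ε : ℝ), 0 < ε →
      ∃ (f : Z → A) (hf : ∀ z, 𝒜.proj (f z) = E.left.r z),
        Continuous f ∧
        (∀ (γ : G) (z : Z) (h : Γ.s γ = E.left.r z),
          f (E.left.act γ z h) = (D.α γ ⟨f z, (hf z).trans h.symm⟩).pt) ∧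
        ‖(⟨f z₀, hf z₀⟩ : Fibre 𝒜.proj (E.left.r z₀)) - a‖ ≤ ε) ∧
    (E.basicBundle D).HasEnoughSections := by
  have : T2Space Y := Δ.isClosedEmbedding_unit.isEmbedding.t2Space
  have : LocallyCompactSpace Y := Δ.isClosedEmbedding_unit.locallyCompactSpace
  have hsec : (E.basicBundle D).HasEnoughSections := CStarBundle.hasEnoughSections
  refine ⟨fun z₀ a ε hε => ?_, hsec⟩
  -- A section of `𝒜_Z` through `[(z₀, a)]`; its lift represents the same class over `z₀`, hence
  -- equals `a` there.
  obtain ⟨F, hFp, hF, -, hFa⟩ := hsec (E.right.s z₀) (E.basicMk D z₀ rfl a)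
  obtain ⟨f, hf, hfc, hfe, hfF⟩ := E.exists_continuous_equivariant D hF hFp
  refine ⟨f, hf, hfc, hfe, ?_⟩
  have h1 : f z₀ = a.pt := E.toBasic_injective D (hf z₀) a.proj_pt
    ((hfF z₀).trans (congrArg Fibre.pt hFa))
  have h2 : (⟨f z₀, hf z₀⟩ : Fibre 𝒜.proj (E.left.r z₀)) = a := Fibre.ext h1
  rw [h2, sub_self, norm_zero]
  exact hε.le
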